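/- Let $\mathcal{D}$ be a small category in which every map factors as a split epimorphism followed by a split monomorphism, and let $\mathrm{Psh}(\mathcal{D}) = [\mathcal{D}^{\mathrm{op}}, \mathbf{Set}]$ be its presheaf topos. A \emph{subtopos} of a topos $\mathcal{E}$ is a fully faithful functor $l_* : \mathcal{L} \to \mathcal{E}$ with a finite-limit-preserving left adjoint $l^*$. A \emph{level} of $\mathcal{E}$ is a string of adjoint functors $l_! \dashv l^* \dashv l_* : \mathcal{L} \to \mathcal{E}$ with $l_!$ and $l_*$ fully faithful; it has an underlying subtopos, given by $l^* \dashv l_*$. Subtoposes, and hence levels, are ordered by $l \leq m$ if and only if $l_*$ factors through $m_*$ up to natural isomorphism, and two levels $l, m$ are identified when $l \leq m$ and $m \leq l$, that is, when they represent the same subtopos. A full subcategory $\mathcal{C}$ of $\mathcal{D}$ is \emph{closed under subobjects} if, for every monomorphism $D \to C$ of $\mathcal{D}$ with $C$ in $\mathcal{C}$, the object $D$ is in $\mathcal{C}$. (1) Sending a full subcategory $i : \mathcal{C} \to \mathcal{D}$ closed under subobjects to the level $\mathrm{Lan}_{i^{\mathrm{op}}} \dashv (i^{\mathrm{op}})^*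 \dashv \mathrm{Ran}_{i^{\mathrm{op}}} : \mathrm{Psh}(\mathcal{C}) \to \mathrm{Psh}(\mathcal{D})$ is a bijection from the set of full subcategories of $\mathcal{D}$ closed under subobjects, ordered by inclusion, onto the poset of levels of $\mathrm{Psh}(\mathcal{D})$, and this bijection preserves and reflects the order. (2) If, moreover, every object of $\mathcal{D}$ has only finitely many subobjects, then every subtopos of $\mathrm{Psh}(\mathcal{D})$ is a level; that is, for every subtopos $l^* \dashv l_*$ of $\mathrm{Psh}(\mathcal{D})$, the functor $l^*$ has a left adjoint $l_!$, which is moreover fully faithful. -/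

import Mathlib

open CategoryTheory CategoryTheory.Limits

universe u v w

/-- A (representative of a) subtopos of a topos `E`: a geometric inclusion into `E`, that is,
a fully faithful direct image functor `direct` with a left adjoint `inverse` preserving finite
limits. (When `E` is a topos, the domain `dom` of such an inclusion is then a topos.) -/
structure Subtopos (E : Type w) [Category.{v} E] where
  /-- the domain of the inclusion -/
  dom : Type w
  /-- the category structure of the domain -/
  [cat : Category.{v} dom]
  /-- the inverse image functor -/
  inverse : E ⥤ dom
  /-- the direct image functor -/
  direct : dom ⥤ E
  /-- the inverse image is left adjoint to the direct image -/
  adj : inverse ⊣ direct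
  full_direct : direct.Full
  faithful_direct : direct.Faithful
  lex_inverse : PreservesFiniteLimits inverse

attribute [instance] Subtopos.cat

/-- Inclusion of subtoposes: the direct image of the first factors, up to natural isomorphism,
through the direct image of the second. -/
instance Subtopos.instPreorder (E : Type w) [Category.{v} E] : Preorder (Subtopos E) where
  le S T := ∃ G : S.dom ⥤ T.dom, Nonempty (G ⋙ T.direct ≅ S.direct)
  le_refl S := ⟨𝟭 _, ⟨S.direct.leftUnitor⟩⟩
  le_trans S T U := by
    rintro ⟨G, ⟨g⟩⟩ ⟨H, ⟨h⟩⟩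
    exact ⟨G ⋙ H, ⟨Functor.associator G H U.direct ≪≫ Functor.isoWhiskerLeft G h ≪≫ g⟩⟩

/-- A (representative of a) level of `E`: a string of adjoint functors
`skeletal ⊣ inverse ⊣ direct`, with `skeletal, direct : dom ⥤ E` fully faithful. -/
structure Level (E : Type w) [Category.{v} E] where
  /-- the domain of the level -/
  dom : Type w
  /-- the category structure of the domain -/
  [cat : Category.{v} dom]
  /-- the leftmost adjoint, or skeletal inclusion -/
  skeletal : dom ⥤ E
  /-- the inverse image functor -/
  inverse : E ⥤ dom
  /-- the direct image functor -/
  direct : dom ⥤ E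
  /-- the skeletal inclusion is left adjoint to the inverse image -/
  skeletalAdj : skeletal ⊣ inverse
  /-- the inverse image is left adjoint to the direct image -/
  adj : inverse ⊣ direct
  full_skeletal : skeletal.Full
  faithful_skeletal : skeletal.Faithful
  full_direct : direct.Full
  faithful_direct : direct.Faithful

attribute [instance] Level.cat

/-- The (essential) subtopos underlying a level. The inverse image preserves all limits,
being a right adjoint. -/
def Level.toSubtopos {E : Type w} [Category.{v} E] (l : Level E) : Subtopos E where
  dom := l.dom
  inverse := l.inverse
  direct := l.direct
  adj := l.adj
  full_direct := l.full_direct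
  faithful_direct := l.faithful_direct
  lex_inverse := by
    have := l.skeletalAdj.rightAdjoint_preservesLimits.{0, 0}
    exact ⟨fun J _ _ => inferInstance⟩

/-- Levels are ordered as subtoposes. -/
instance Level.instPreorder (E : Type w) [Category.{v} E] : Preorder (Level E) :=
  Preorder.lift Level.toSubtopos

/-- The partially ordered collection of levels of `E`: strings of adjoints as in `Level`,
two of them being identified when they represent the same subtopos. -/
abbrev Levels (E : Type w) [Category.{v} E] : Type _ :=
  Antisymmetrization (Level E) (· ≤ ·)

/-- The level `Psh(C) → Psh(D)` induced by a full subcategory `C` of a small category `D`: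
left Kan extension, restriction and right Kan extension along the inclusion. -/
noncomputable def presheafLevel {D : Type u} [SmallCategory D] (C : ObjectProperty D) :
    Level (Dᵒᵖ ⥤ Type u) where
  dom := C.FullSubcategoryᵒᵖ ⥤ Type u
  skeletal := C.ι.op.lan
  inverse := (Functor.whiskeringLeft _ _ _).obj C.ι.op
  direct := C.ι.op.ran
  skeletalAdj := C.ι.op.lanAdjunction (Type u)
  adj := C.ι.op.ranAdjunction (Type u)
  full_skeletal := (C.ι.op.lanAdjunction (Type u)).fullyFaithfulLOfIsIsoUnit.full
  faithful_skeletal := (C.ι.op.lanAdjunction (Type u)).fullyFaithfulLOfIsIsoUnit.faithful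
  full_direct := (C.ι.op.ranAdjunction (Type u)).fullyFaithfulROfIsIsoCounit.full
  faithful_direct := (C.ι.op.ranAdjunction (Type u)).fullyFaithfulROfIsIsoCounit.faithful

/-! Subtoposes of a presheaf topos correspond, with order reversed, to Grothendieck topologies on
`D`: a sieve covers exactly when the inverse image inverts its inclusion (`mem_topology_iff`,
`le_iff_topology_le`). The extra left adjoint of a level makes covering sieves closed under
arbitrary intersections, so every object has a least covering sieve. Split epi–split mono
factorization then forces this sieve to be generated by maps from objects covered only by the
maximal sieve, which identifies the topology with that of a full subcategory
(`topology_presheafLevel_irreducibleObjects`). With finitely many subobjects there are finitely many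
sieves, so least covering sieves exist for every subtopos. -/

namespace Subtopos

open Opposite

attribute [instance] full_direct faithful_direct lex_inverse

/-! ### Subtoposes of presheaf toposes as topologies -/

section Presheaf

variable {D : Type u} [SmallCategory D] (S : Subtopos (Dᵒᵖ ⥤ Type u))

/-- The Grothendieck topology of a subtopos of a presheaf topos: the finest one for which
all presheaves in the image of the direct image functor are sheaves. -/
def topology : GrothendieckTopology D :=
  Sheaf.finestTopology (Set.range S.direct.obj)

lemma isSheaf_direct (B : S.dom) : Presieve.IsSheaf S.topology (S.direct.obj B) :=
  Sheaf.sheaf_for_finestTopology _ (Set.mem_range_self B)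

lemma isSheafFor_direct_iff {X : D} (R : Sieve X) :
    (∀ B, Presieve.IsSheafFor (S.direct.obj B) R.arrows) ↔
      IsIso (S.inverse.map R.functorInclusion) := by
  rw [← ObjectProperty.isLocal_iff_isIso_map S.adj]
  simp only [Presieve.isSheafFor_iff_yonedaSheafCondition, Presieve.YonedaSheafCondition,
    ← Function.bijective_iff_existsUnique]
  constructor
  · rintro h _ ⟨B, rfl⟩
    exact h B
  · exact fun h B => h _ ⟨B, rfl⟩

/-- Lets a lex functor inverting `U.ι` also invert the sieve inclusion. -/
lemma isPullback_sieveOfSection {B : Dᵒᵖ ⥤ Type u} (U : Subfunctor B) {X : D} (s : B.obj (op X)) :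
    ∃ t : (U.sieveOfSection s).functor ⟶ U.toFunctor,
      IsPullback t (U.sieveOfSection s).functorInclusion U.ι (yonedaEquiv.symm s) := by
  refine ⟨{ app := fun Y => ↾fun f => ⟨B.map f.1.op s, f.2⟩, naturality := ?_ }, ?_⟩
  · intro Y Z g
    ext f
    apply Subtype.ext
    change B.map (g.unop ≫ f.1).op s = B.map g (B.map f.1.op s)
    simp
  · refine IsPullback.of_forall_isPullback_app fun Y => ?_
    rw [Types.isPullback_iff]
    refine ⟨rfl, fun f g h => Subtype.ext h.2, fun x f h => ?_⟩
    have h' : x.1 = B.map f.op s := h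
    exact ⟨⟨f, show B.map f.op s ∈ U.obj _ from h' ▸ x.2⟩, Subtype.ext h'.symm, rfl⟩

lemma isIso_inverse_map_sieveOfSection {B : Dᵒᵖ ⥤ Type u} (U : Subfunctor B)
    [IsIso (S.inverse.map U.ι)] {X : D} (s : B.obj (op X)) :
    IsIso (S.inverse.map (U.sieveOfSection s).functorInclusion) := by
  obtain ⟨t, ht⟩ := isPullback_sieveOfSection U s
  exact (ht.map S.inverse).isIso_snd_of_isIso

lemma sieveOfSection_mem {B : Dᵒᵖ ⥤ Type u} (U : Subfunctor B)
    [IsIso (S.inverse.map U.ι)] {X : D} (s : B.obj (op X)) :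
    U.sieveOfSection s ∈ S.topology X := by
  apply Sheaf.mem_finestTopology_of_forall_isSheafFor
  rintro _ ⟨B', rfl⟩ Y f
  have h : (U.sieveOfSection s).pullback f = U.sieveOfSection (B.map f.op s) := by
    ext Z g
    simp [Subfunctor.sieveOfSection]
  rw [h]
  exact (S.isSheafFor_direct_iff _).2 (S.isIso_inverse_map_sieveOfSection U _) B'

lemma isIso_inverse_map_range_ι {A B : Dᵒᵖ ⥤ Type u} (f : A ⟶ B) [IsIso (S.inverse.map f)] :
    IsIso (S.inverse.map (Subfunctor.range f).ι) := by
  have : IsSplitEpi (S.inverse.map (Subfunctor.range f).ι) :=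
    IsSplitEpi.mk' ⟨inv (S.inverse.map f) ≫ S.inverse.map (Subfunctor.toRange f), by
      rw [Category.assoc, ← S.inverse.map_comp, Subfunctor.toRange_ι, IsIso.inv_hom_id]⟩
  exact isIso_of_mono_of_isSplitEpi _

lemma imageSieve_mem_topology {A B : Dᵒᵖ ⥤ Type u} (f : A ⟶ B) [IsIso (S.inverse.map f)]
    {X : D} (s : B.obj (op X)) : Presheaf.imageSieve f s ∈ S.topology X := by
  have := S.isIso_inverse_map_range_ι f
  exact S.sieveOfSection_mem (Subfunctor.range f) s

lemma mem_topology_iff {X : D} (R : Sieve X) :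
    R ∈ S.topology X ↔ IsIso (S.inverse.map R.functorInclusion) := by
  constructor
  · intro h
    exact (S.isSheafFor_direct_iff R).1 fun B => S.isSheaf_direct B R h
  · intro h
    convert S.imageSieve_mem_topology R.functorInclusion (X := X) (𝟙 X) using 1
    ext Y f
    constructor
    · intro hf
      exact ⟨⟨f, hf⟩, (Category.comp_id f).symm⟩
    · rintro ⟨⟨g, hg⟩, h⟩
      have h' : g = f := h.trans (Category.comp_id f)
      exact h' ▸ hg

lemma isLocallySurjective {A B : Dᵒᵖ ⥤ Type u} (f : A ⟶ B) [IsIso (S.inverse.map f)] :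
    Presheaf.IsLocallySurjective S.topology f where
  imageSieve_mem s := S.imageSieve_mem_topology f s

lemma isLocallyInjective {A B : Dᵒᵖ ⥤ Type u} (f : A ⟶ B) [IsIso (S.inverse.map f)] :
    Presheaf.IsLocallyInjective S.topology f where
  equalizerSieve_mem {X} x y h := by
    -- The diagonal of `f` is inverted as well; local surjectivity of the diagonal at `(x, y)` is
    -- local equality of `x` and `y`.
    have hp := (IsPullback.of_hasPullback f f).map S.inverse
    have : IsIso (S.inverse.map (pullback.fst f f)) := hp.isIso_fst_of_isIso
    have : IsIso (S.inverse.map (pullback.diagonal f)) := by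
      have : IsIso (S.inverse.map (pullback.diagonal f) ≫ S.inverse.map (pullback.fst f f)) := by
        rw [← S.inverse.map_comp, pullback.diagonal_fst]
        infer_instance
      exact IsIso.of_isIso_comp_right _ (S.inverse.map (pullback.fst f f))
    obtain ⟨p, hp₁, hp₂⟩ := ((Types.isPullback_iff _ _ _ _).1
      ((IsPullback.of_hasPullback f f).app X)).2.2 x y h
    refine S.topology.superset_covering ?_
      (S.imageSieve_mem_topology (pullback.diagonal f) (X := X.unop) p)
    rintro Y g ⟨t, ht⟩
    have h₁ := congr_arg ((pullback.fst f f).app (op Y)) ht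
    have h₂ := congr_arg ((pullback.snd f f).app (op Y)) ht
    rw [NatTrans.naturality_apply] at h₁ h₂
    rw [← NatTrans.comp_app_apply, pullback.diagonal_fst] at h₁
    rw [← NatTrans.comp_app_apply, pullback.diagonal_snd] at h₂
    change A.map g.op x = A.map g.op y
    rw [← hp₁, ← hp₂]
    exact h₁.symm.trans h₂

/-- The unit at `A` is inverted by `S.inverse`, hence is a locally bijective map between sheaves,
hence an isomorphism. -/
lemma mem_essImage_direct {A : Dᵒᵖ ⥤ Type u} (hA : Presieve.IsSheaf S.topology A) :
    S.direct.essImage A := by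
  rw [← S.adj.isIso_unit_app_iff_mem_essImage]
  let η : A ⟶ S.direct.obj (S.inverse.obj A) := S.adj.unit.app A
  have : IsIso (S.inverse.map η) := by
    dsimp only [η]
    infer_instance
  have := S.isLocallyInjective η
  have := S.isLocallySurjective η
  let F : Sheaf S.topology (Type u) := ⟨A, (isSheaf_iff_isSheaf_of_type _ _).2 hA⟩
  let G : Sheaf S.topology (Type u) := ⟨_, (isSheaf_iff_isSheaf_of_type _ _).2
    (S.isSheaf_direct (S.inverse.obj A))⟩
  let φ : F ⟶ G := ⟨η⟩
  have : IsIso φ := Sheaf.isLocallyBijective_iff_isIso φ |>.1 ⟨‹_›, ‹_›⟩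
  exact inferInstanceAs (IsIso ((sheafToPresheaf _ _).map φ))

end Presheaf

/-! ### Comparison of subtoposes -/

variable {E : Type w} [Category.{v} E]

lemma isIso_inverse_map_of_le {S T : Subtopos E} (h : S ≤ T) {A B : E} (f : A ⟶ B)
    [hf : IsIso (T.inverse.map f)] : IsIso (S.inverse.map f) := by
  obtain ⟨G, ⟨g⟩⟩ := h
  rw [← ObjectProperty.isLocal_iff_isIso_map T.adj] at hf
  rw [← ObjectProperty.isLocal_iff_isIso_map S.adj]
  rintro _ ⟨B, rfl⟩
  have h := hf _ ⟨G.obj B, rfl⟩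
  let e := g.app B
  constructor
  · intro x y hxy
    have := @h.1 (x ≫ e.inv) (y ≫ e.inv) (by simpa using congr_arg (· ≫ e.inv) hxy)
    simpa using this
  · intro x
    obtain ⟨y, hy⟩ := h.2 (x ≫ e.inv)
    exact ⟨y ≫ e.hom, by simpa using congr_arg (· ≫ e.hom) hy⟩

/-- A subtopos whose direct images lie in the essential image of another factors through it. -/
noncomputable def directFactorization (S T : Subtopos E)
    (h : ∀ B, T.direct.essImage (S.direct.obj B)) :
    (S.direct ⋙ T.inverse) ⋙ T.direct ≅ S.direct :=
  (NatIso.ofComponents (fun B =>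
    have := T.adj.isIso_unit_app_iff_mem_essImage.2 (h B)
    asIso (T.adj.unit.app (S.direct.obj B))) (fun _ => T.adj.unit.naturality _)).symm

lemma essImage_of_le {S T : Subtopos E} (h : S ≤ T) (B : S.dom) :
    T.direct.essImage (S.direct.obj B) := by
  obtain ⟨G, ⟨g⟩⟩ := h
  exact ⟨G.obj B, ⟨g.app B⟩⟩

lemma le_iff_topology_le {D : Type u} [SmallCategory D] {S T : Subtopos (Dᵒᵖ ⥤ Type u)} :
    S ≤ T ↔ T.topology ≤ S.topology := by
  constructor
  · intro h X R hR
    change R ∈ T.topology X at hR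
    rw [mem_topology_iff] at hR ⊢
    exact isIso_inverse_map_of_le h _
  · intro h
    exact ⟨_, ⟨S.directFactorization T fun B => T.mem_essImage_direct
      (Presieve.isSheaf_of_le _ h (S.isSheaf_direct B))⟩⟩

/-- The inverse image of a subtopos factors through that of any larger subtopos. -/
noncomputable def inverseFactorization {S T : Subtopos E} (h : S ≤ T) :
    T.inverse ⋙ (T.direct ⋙ S.inverse) ≅ S.inverse :=
  have (A : E) : IsIso ((Functor.whiskerRight T.adj.unit S.inverse).app A) :=
    isIso_inverse_map_of_le h (T.adj.unit.app A)
  have := NatIso.isIso_of_isIso_app (Functor.whiskerRight T.adj.unit S.inverse)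
  (asIso (Functor.whiskerRight T.adj.unit S.inverse)).symm

lemma isEquivalence_of_le_of_le {S T : Subtopos E} (h : S ≤ T) (h' : T ≤ S) :
    (T.direct ⋙ S.inverse).IsEquivalence :=
  have e (S T : Subtopos E) (h : S ≤ T) :
      (S.direct ⋙ T.inverse) ⋙ (T.direct ⋙ S.inverse) ≅ 𝟭 S.dom :=
    Functor.isoWhiskerRight (S.directFactorization T (essImage_of_le h)) S.inverse ≪≫
      asIso S.adj.counit
  (CategoryTheory.Equivalence.mk _ _ (e T S h').symm (e S T h)).isEquivalence_functor

/-- A subtopos equivalent to a level is a level. -/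
lemma exists_level_of_equiv {S : Subtopos E} (l : Level E) (h : S ≤ l.toSubtopos)
    (h' : l.toSubtopos ≤ S) : ∃ m : Level E, m.toSubtopos = S := by
  have := isEquivalence_of_le_of_le h h'
  have : l.toSubtopos.inverse.IsRightAdjoint := l.skeletalAdj.isRightAdjoint
  have : S.inverse.IsRightAdjoint := Functor.isRightAdjoint_of_iso (inverseFactorization h)
  have adj := Adjunction.ofIsRightAdjoint S.inverse
  -- In an adjoint triple the outer functors are fully faithful together.
  have ff := (Adjunction.Triple.mk adj S.adj).fullyFaithfulEquiv.symm
    (Functor.FullyFaithful.ofFullyFaithful S.direct)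
  exact ⟨{
    dom := S.dom
    skeletal := _
    inverse := S.inverse
    direct := S.direct
    skeletalAdj := adj
    adj := S.adj
    full_skeletal := ff.full
    faithful_skeletal := ff.faithful
    full_direct := S.full_direct
    faithful_direct := S.faithful_direct }, rfl⟩

end Subtopos

/-! ### Topologies of levels and least covering sieves -/

section

open Opposite

variable {D : Type u} [SmallCategory D]

lemma mem_topology_presheafLevel_iff (C : ObjectProperty D) {X : D} (R : Sieve X) :
    R ∈ (presheafLevel C).toSubtopos.topology X ↔ ∀ ⦃Z : D⦄ (f : Z ⟶ X), C Z → R f := by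
  rw [Subtopos.mem_topology_iff]
  change IsIso (Functor.whiskerLeft C.ι.op R.functorInclusion) ↔ _
  rw [NatTrans.isIso_iff_isIso_app]
  constructor
  · intro h Z f hZ
    obtain ⟨g, hg⟩ := ((isIso_iff_bijective _).1 (h (op ⟨Z, hZ⟩))).2 f
    have hg' : g.1 = f := hg
    exact hg' ▸ g.2
  · intro h Z
    rw [isIso_iff_bijective]
    exact ⟨fun f g hfg => Subtype.ext hfg, fun f => ⟨⟨f, h f Z.unop.2⟩, rfl⟩⟩

/-- The covering sieves of the topology of a level are closed under arbitrary intersections. -/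
lemma Level.sInf_mem_topology (l : Level (Dᵒᵖ ⥤ Type u)) {X : D} (s : Set (Sieve X))
    (hs : ∀ R ∈ s, R ∈ l.toSubtopos.topology X) : sInf s ∈ l.toSubtopos.topology X := by
  -- By transposition, `R` covers iff all maps from skeletal objects to the representable land in
  -- `R`, a condition visibly stable under intersections.
  have key (R : Sieve X) : R ∈ l.toSubtopos.topology X ↔
      ∀ (B : l.dom) (x : l.skeletal.obj B ⟶ yoneda.obj X) (Z : Dᵒᵖ)
        (z : (l.skeletal.obj B).obj Z), R (x.app Z z : Z.unop ⟶ X) := by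
    rw [Subtopos.mem_topology_iff]
    change IsIso (l.inverse.map R.functorInclusion) ↔ _
    constructor
    · intro h B x Z z
      let y := l.skeletalAdj.homEquiv _ _ x ≫ inv (l.inverse.map R.functorInclusion)
      have hy : (l.skeletalAdj.homEquiv _ _).symm y ≫ R.functorInclusion = x := by
        rw [← Adjunction.homEquiv_naturality_right_symm]
        simp [y]
      have := ((((l.skeletalAdj.homEquiv _ _).symm y).app Z z)).2
      have e : ((((l.skeletalAdj.homEquiv _ _).symm y).app Z z)).1 = x.app Z z := by
        rw [← hy]
        rfl
      exact e ▸ this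
    · intro h
      have : Mono (l.inverse.map R.functorInclusion) :=
        have := l.skeletalAdj.isRightAdjoint
        inferInstance
      -- The universal such map, the counit; its lift to `R` transposes to a section of the mono
      -- `l.inverse.map R.functorInclusion`.
      let x := (l.skeletalAdj.homEquiv _ _).symm (𝟙 (l.inverse.obj (yoneda.obj X)))
      let y : l.skeletal.obj (l.inverse.obj (yoneda.obj X)) ⟶ R.functor :=
        { app := fun Z => ↾fun z => ⟨x.app Z z, h _ x Z z⟩
          naturality := fun Z Z' f => by
            ext z
            apply Subtype.ext
            exact NatTrans.naturality_apply x f z }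
      have hy : y ≫ R.functorInclusion = x := rfl
      have : IsSplitEpi (l.inverse.map R.functorInclusion) :=
        IsSplitEpi.mk' ⟨l.skeletalAdj.homEquiv _ _ y, by
          rw [← Adjunction.homEquiv_naturality_right, hy, Equiv.apply_symm_apply]⟩
      exact isIso_of_mono_of_isSplitEpi _
  rw [key]
  intro B x Z z R hR
  exact (key R).1 (hs R hR) B x Z z

namespace CategoryTheory.GrothendieckTopology

variable (J : GrothendieckTopology D)

/-- The objects covered by the maximal sieve only. -/
def irreducibleObjects : ObjectProperty D :=
  fun X => ∀ R ∈ J X, R = ⊤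

lemma isClosedUnderSubobjects_irreducibleObjects
    (hD : ∀ ⦃X Y : D⦄ (f : X ⟶ Y) [Mono f], IsSplitMono f) :
    J.irreducibleObjects.IsClosedUnderSubobjects where
  prop_of_mono {Z X} m _ hX R hR := by
    have := hD m
    have h := hX _ (J.pullback_stable (retraction m) hR)
    rw [← Sieve.id_mem_iff_eq_top, ← IsSplitMono.id m]
    apply (Sieve.mem_iff_pullback_eq_top _).2
    rw [Sieve.pullback_comp, h, Sieve.pullback_top]

/-- If each object has a least covering sieve and maps factor as a split epimorphism followed by
a split monomorphism, then the covering sieves are those containing all maps from irreducible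
objects. -/
lemma mem_iff_of_least_covering
    (hD : ∀ ⦃X Y : D⦄ (f : X ⟶ Y), ∃ (Z : D) (e : X ⟶ Z) (m : Z ⟶ Y),
      IsSplitEpi e ∧ IsSplitMono m ∧ e ≫ m = f)
    (hJ : ∀ X : D, sInf {R | R ∈ J X} ∈ J X) {X : D} (R : Sieve X) :
    R ∈ J X ↔ ∀ ⦃Z : D⦄ (f : Z ⟶ X), J.irreducibleObjects Z → R f := by
  let M (X : D) : Sieve X := sInf {R | R ∈ J X}
  have hM {X : D} {R : Sieve X} (hR : R ∈ J X) : M X ≤ R := sInf_le hR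
  constructor
  · intro hR Z f hZ
    exact (Sieve.mem_iff_pullback_eq_top f).2 (hZ _ (J.pullback_stable f hR))
  · intro h
    refine J.superset_covering ?_ (hJ X)
    intro Y f hf
    obtain ⟨Z, e, m, _, _, rfl⟩ := hD f
    refine R.downward_closed (h m ?_) e
    have hm : M X m := by
      have := (M X).downward_closed hf (section_ e)
      rwa [IsSplitEpi.id_assoc] at this
    -- Composing least covers gives a cover, so `m` factors as `i ≫ g` with `i` in the least cover
    -- of `Y'`. Any cover `R'` of `Z`, pulled back along `g ≫ retraction m`, contains `i`; hence
    -- `R'` contains `𝟙 Z`, and `Z` is irreducible.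
    obtain ⟨Y', i, g, hg, hi, hig⟩ :
        (Sieve.bind (M X).arrows fun Y _ _ => M Y) m :=
      hM (J.bind_covering (hJ X) fun _ _ _ => hJ _) _ hm
    intro R' hR'
    have := hM (J.pullback_stable (g ≫ retraction m) hR') _ hi
    rwa [Sieve.pullback_apply, reassoc_of% hig, IsSplitMono.id, Sieve.id_mem_iff_eq_top] at this

end CategoryTheory.GrothendieckTopology

/-- By the factorization, a sieve is determined by the subobjects it contains. -/
lemma finite_sieve (hD : ∀ ⦃X Y : D⦄ (f : X ⟶ Y), ∃ (Z : D) (e : X ⟶ Z) (m : Z ⟶ Y),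
      IsSplitEpi e ∧ IsSplitMono m ∧ e ≫ m = f) (X : D) [Finite (Subobject X)] :
    Finite (Sieve X) := by
  refine Finite.of_injective
    (fun R : Sieve X => {P : Subobject X | R P.arrow}) fun R R' h => ?_
  have key (R : Sieve X) {Z : D} (m : Z ⟶ X) [Mono m] :
      R m ↔ Subobject.mk m ∈ {P : Subobject X | R P.arrow} := by
    constructor
    · intro h
      change R (Subobject.mk m).arrow
      rw [← Subobject.underlyingIso_hom_comp_eq_mk m]
      exact R.downward_closed h _
    · intro h
      rw [← Subobject.underlyingIso_arrow m]
      exact R.downward_closed h _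
  ext Y f
  obtain ⟨Z, e, m, _, _, rfl⟩ := hD f
  have iff (R : Sieve X) : R (e ≫ m) ↔ R m :=
    ⟨fun h => by simpa using R.downward_closed h (section_ e), fun h => R.downward_closed h e⟩
  rw [iff, iff, key, key]
  exact Set.ext_iff.1 h _

lemma CategoryTheory.GrothendieckTopology.sInf_mem_of_finite (J : GrothendieckTopology D) {X : D}
    {s : Set (Sieve X)} (hs : s.Finite) (h : ∀ R ∈ s, R ∈ J X) : sInf s ∈ J X := by
  induction s, hs using Set.Finite.induction_on with
  | empty => simp
  | insert _ _ ih =>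
    rw [sInf_insert]
    exact J.intersection_covering (h _ (Set.mem_insert _ _))
      (ih fun R hR => h R (Set.mem_insert_of_mem _ hR))

lemma presheafLevel_le_iff (C C' : ObjectProperty D) [C'.IsClosedUnderSubobjects] :
    presheafLevel C ≤ presheafLevel C' ↔ C ≤ C' := by
  change (presheafLevel C).toSubtopos ≤ (presheafLevel C').toSubtopos ↔ _
  rw [Subtopos.le_iff_topology_le]
  constructor
  · intro h X hX
    -- The least sieve covering for `C'`; if it also covers for `C`, it contains `𝟙 X`, making `X` a
    -- retract of an object of `C'`.
    let R : Sieve X :=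
      { arrows := fun Y f => ∃ (Z : D) (g : Y ⟶ Z) (k : Z ⟶ X), C' Z ∧ g ≫ k = f
        downward_closed := by
          rintro Y Y' _ ⟨Z, g, k, hZ, rfl⟩ f
          exact ⟨Z, f ≫ g, k, hZ, Category.assoc _ _ _⟩ }
    have hR := h X ((mem_topology_presheafLevel_iff C' R).2
      fun Z f hZ => ⟨Z, 𝟙 Z, f, hZ, Category.id_comp f⟩)
    obtain ⟨Z, g, k, hZ, hgk⟩ := (mem_topology_presheafLevel_iff C R).1 hR (𝟙 X) hX
    have : IsSplitMono g := IsSplitMono.mk' ⟨k, hgk⟩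
    exact C'.prop_of_mono g hZ
  · intro h X R hR
    exact (mem_topology_presheafLevel_iff C R).2
      fun Z f hZ => (mem_topology_presheafLevel_iff C' R).1 hR f (h Z hZ)

/-- A topology with least covering sieves is the topology of the level induced by the full
subcategory of its irreducible objects. -/
lemma topology_presheafLevel_irreducibleObjects
    (hD : ∀ ⦃X Y : D⦄ (f : X ⟶ Y), ∃ (Z : D) (e : X ⟶ Z) (m : Z ⟶ Y),
      IsSplitEpi e ∧ IsSplitMono m ∧ e ≫ m = f)
    (J : GrothendieckTopology D) (hJ : ∀ X : D, sInf {R | R ∈ J X} ∈ J X) :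
    (presheafLevel J.irreducibleObjects).toSubtopos.topology = J := by
  ext X R
  rw [mem_topology_presheafLevel_iff, J.mem_iff_of_least_covering hD hJ]

lemma isSplitMono_of_mono
    (hD : ∀ ⦃X Y : D⦄ (f : X ⟶ Y), ∃ (Z : D) (e : X ⟶ Z) (m : Z ⟶ Y),
      IsSplitEpi e ∧ IsSplitMono m ∧ e ≫ m = f) ⦃X Y : D⦄ (f : X ⟶ Y) [Mono f] :
    IsSplitMono f := by
  obtain ⟨Z, e, m, _, _, rfl⟩ := hD f
  have : Mono e := mono_of_mono e m
  have := isIso_of_mono_of_isSplitEpi e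
  infer_instance

end

theorem mainTheorem5 {D : Type u} [SmallCategory D]
    (hD : ∀ ⦃X Y : D⦄ (f : X ⟶ Y), ∃ (Z : D) (e : X ⟶ Z) (m : Z ⟶ Y),
      IsSplitEpi e ∧ IsSplitMono m ∧ e ≫ m = f) :
    (∃ Φ : {C : ObjectProperty D // C.IsClosedUnderSubobjects} ≃o Levels (Dᵒᵖ ⥤ Type u),
      ∀ C, Φ C = toAntisymmetrization (· ≤ ·) (presheafLevel C.1)) ∧
    ((∀ X : D, Finite (Subobject X)) →
      ∀ S : Subtopos (Dᵒᵖ ⥤ Type u), ∃ l : Level (Dᵒᵖ ⥤ Type u), l.toSubtopos = S) := by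
  have hmono := isSplitMono_of_mono hD
  constructor
  · let φ : {C : ObjectProperty D // C.IsClosedUnderSubobjects} ↪o Levels (Dᵒᵖ ⥤ Type u) :=
      OrderEmbedding.ofMapLEIff
        (fun C => toAntisymmetrization (· ≤ ·) (presheafLevel C.1)) fun C C' => by
          have := C'.2
          exact presheafLevel_le_iff C.1 C'.1
    refine ⟨RelIso.ofSurjective φ ?_, fun C => rfl⟩
    intro q
    induction q using Antisymmetrization.ind with
    | _ l =>
      refine ⟨⟨l.toSubtopos.topology.irreducibleObjects,
        l.toSubtopos.topology.isClosedUnderSubobjects_irreducibleObjects hmono⟩, ?_⟩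
      have h := topology_presheafLevel_irreducibleObjects hD l.toSubtopos.topology
        fun X => l.sInf_mem_topology _ fun _ hR => hR
      exact Quotient.sound
        ⟨Subtopos.le_iff_topology_le.2 h.ge, Subtopos.le_iff_topology_le.2 h.le⟩
  · intro hfin S
    have h := topology_presheafLevel_irreducibleObjects hD S.topology fun X => by
      have := finite_sieve hD X
      exact S.topology.sInf_mem_of_finite (Set.toFinite _) fun _ hR => hR
    exact Subtopos.exists_level_of_equiv (presheafLevel S.topology.irreducibleObjects)
      (Subtopos.le_iff_topology_le.2 h.le) (Subtopos.le_iff_topology_le.2 h.ge)
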